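/- Let $(M^{2n+1},\phi,\xi,\eta,g)$ be an almost contact metric manifold, that is, a smooth $(2n+1)$-dimensional Riemannian manifold $(M,g)$ with a smooth $(1,1)$-tensor field $\phi$, a smooth vector field $\xi$ and a smooth $1$-form $\eta$ such that $\eta(\xi)=1$, $\phi^2X=-X+\eta(X)\xi$ and $g(\phi X,\phi Y)=g(X,Y)-\eta(X)\eta(Y)$ for all vector fields $X,Y$. Define $h$ by $2h=L_\xi\phi$, i.e. $2hX=[\xi,\phi X]-\phi[\xi,X]$, and use the conventions $R(X,Y)Z=\nabla_X\nabla_YZ-\nabla_Y\nabla_XZ-\nabla_{[X,Y]}Z$ ($\nabla$ the Levi-Civita connection of $g$) and $d\eta(X,Y)=\frac12\bigl(X\eta(Y)-Y\eta(X)-\eta([X,Y])\bigr)$. Suppose that $M$ is a generalized $(\kappa,\mu)$-space form $M(f_1,\dots,f_6)$: $f_1,\dots,f_6$ are smooth functions on $M$ with $R=f_1R_1+f_2R_2+f_3R_3+f_4R_4+f_5R_5+f_6R_6$, where, for all vector fields $X,Y,Z$, \begin{align*} R_1(X,Y)Z&=g(Y,Z)X-g(X,Z)Y,\\ R_2(X,Y)Z&=g(X,\phi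 Z)\phi Y-g(Y,\phi Z)\phi X+2g(X,\phi Y)\phi Z,\\ R_3(X,Y)Z&=\eta(X)\eta(Z)Y-\eta(Y)\eta(Z)X+g(X,Z)\eta(Y)\xi-g(Y,Z)\eta(X)\xi,\\ R_4(X,Y)Z&=g(Y,Z)hX-g(X,Z)hY+g(hY,Z)X-g(hX,Z)Y,\\ R_5(X,Y)Z&=g(hY,Z)hX-g(hX,Z)hY+g(\phi hX,Z)\phi hY-g(\phi hY,Z)\phi hX,\\ R_6(X,Y)Z&=\eta(X)\eta(Z)hY-\eta(Y)\eta(Z)hX+g(hX,Z)\eta(Y)\xi-g(hY,Z)\eta(X)\xi. \end{align*} If $M$ is a contact metric manifold, i.e. $d\eta(X,Y)=g(X,\phi Y)$ for all vector fields $X,Y$, and $f_3=f_1-1$, then $M$ is a Sasakian manifold: it is a contact metric manifold and it is normal, i.e. $$\phi^2[X,Y]+[\phi X,\phi Y]-\phi[\phi X,Y]-\phi[X,\phi Y]=-2\,d\eta(X,Y)\,\xi\qquad\text{for all vector fields }X,Y.$$ -/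

import Mathlib

open Bundle VectorField
open scoped Manifold ContDiff

noncomputable section

set_option linter.unusedSectionVars false

namespace AlmostContact

section LeviCivita

variable {E : Type*} [NormedAddCommGroup E] [NormedSpace ℝ E] [FiniteDimensional ℝ E]
  {H : Type*} [TopologicalSpace H] {I : ModelWithCorners ℝ E H}
  {M : Type*} [TopologicalSpace M] [ChartedSpace H M] [IsManifold I ∞ M]
  (g : ContMDiffRiemannianMetric I ∞ E (fun x : M ↦ TangentSpace I x))

/-- The function `x ↦ g(X, Y)(x)`, for two vector fields `X`, `Y`. -/
def metricFun (X Y : Π x : M, TangentSpace I x) (x : M) : ℝ := g.inner x (X x) (Y x)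

theorem metricFun_comm (X Y : Π x : M, TangentSpace I x) :
    metricFun g X Y = metricFun g Y X :=
  funext fun x ↦ g.symm x _ _

theorem mdifferentiableAt_metricFun {X Y : Π x : M, TangentSpace I x} {x : M}
    (hX : MDiffAt (T% X) x) (hY : MDiffAt (T% Y) x) :
    MDifferentiableAt I 𝓘(ℝ, ℝ) (metricFun g X Y) x := by
  have h : MDifferentiableAt I (I.prod 𝓘(ℝ, ℝ))
      (fun m ↦ TotalSpace.mk' ℝ (E := Bundle.Trivial M ℝ) m (g.inner m (X m) (Y m))) x := by
    apply MDifferentiableAt.clm_bundle_apply₂ (F₁ := E) (F₂ := E)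
    · exact g.contMDiff.mdifferentiableAt (by simp)
    · exact hX
    · exact hY
  rw [mdifferentiableAt_totalSpace] at h
  exact h.2

theorem mvfderiv_metricFun_smul {X Y : Π x : M, TangentSpace I x} {f : M → ℝ} {x : M}
    (hf : MDiffAt f x) (hX : MDiffAt (T% X) x) (hY : MDiffAt (T% Y) x) (v : TangentSpace I x) :
    d% (metricFun g (f • X) Y) x v
      = f x * d% (metricFun g X Y) x v + g.inner x (X x) (Y x) * d% f x v := by
  have h : metricFun g (f • X) Y = fun y ↦ f y * metricFun g X Y y := by
    ext y; simp [metricFun]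
  rw [h, mvfderiv_fun_mul hf (mdifferentiableAt_metricFun g hX hY)]
  simp [metricFun]

theorem mvfderiv_metricFun_add {X X' Y : Π x : M, TangentSpace I x} {x : M}
    (hX : MDiffAt (T% X) x) (hX' : MDiffAt (T% X') x) (hY : MDiffAt (T% Y) x)
    (v : TangentSpace I x) :
    d% (metricFun g (X + X') Y) x v
      = d% (metricFun g X Y) x v + d% (metricFun g X' Y) x v := by
  have h : metricFun g (X + X') Y = fun y ↦ metricFun g X Y y + metricFun g X' Y y := by
    ext y; simp [metricFun]
  rw [h, mvfderiv_fun_add (mdifferentiableAt_metricFun g hX hY)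
    (mdifferentiableAt_metricFun g hX' hY)]
  simp

/-- The right-hand side of the Koszul formula
`2 g(∇_X Y, Z) = X g(Y, Z) + Y g(Z, X) - Z g(X, Y) + g([X, Y], Z) - g([Y, Z], X) + g([Z, X], Y)`,
evaluated at the point `x`. -/
def koszul (Y X Z : Π x : M, TangentSpace I x) (x : M) : ℝ :=
  d% (metricFun g Y Z) x (X x) + d% (metricFun g Z X) x (Y x) - d% (metricFun g X Y) x (Z x)
    + g.inner x (mlieBracket I X Y x) (Z x) - g.inner x (mlieBracket I Y Z x) (X x)
    + g.inner x (mlieBracket I Z X x) (Y x)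

theorem koszul_tensorial_left {Y Z : Π x : M, TangentSpace I x} {x : M}
    (hY : MDiffAt (T% Y) x) (hZ : MDiffAt (T% Z) x) :
    TensorialAt I E (fun X ↦ koszul g Y X Z x) x where
  smul {f X} hf hX := by
    simp only [koszul, metricFun_comm g Z (f • X), mvfderiv_metricFun_smul g hf hX hZ,
      mvfderiv_metricFun_smul g hf hX hY, mlieBracket_smul_left hf hX,
      mlieBracket_smul_right hf hX, metricFun_comm g Z X]
    simp [g.symm x (X x)]
    ring
  add {X X'} hX hX' := by
    simp only [koszul, metricFun_comm g Z (X + X'), mvfderiv_metricFun_add g hX hX' hZ,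
      mvfderiv_metricFun_add g hX hX' hY, mlieBracket_add_left hX hX',
      mlieBracket_add_right hX hX', metricFun_comm g Z X, metricFun_comm g Z X']
    simp
    ring

theorem koszul_tensorial_right {Y X : Π x : M, TangentSpace I x} {x : M}
    (hY : MDiffAt (T% Y) x) (hX : MDiffAt (T% X) x) :
    TensorialAt I E (fun Z ↦ koszul g Y X Z x) x where
  smul {f Z} hf hZ := by
    simp only [koszul, metricFun_comm g Y (f • Z), mvfderiv_metricFun_smul g hf hZ hX,
      mvfderiv_metricFun_smul g hf hZ hY, mlieBracket_smul_left hf hZ,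
      mlieBracket_smul_right hf hZ, metricFun_comm g Y Z]
    simp [g.symm x (Z x)]
    ring
  add {Z Z'} hZ hZ' := by
    simp only [koszul, metricFun_comm g Y (Z + Z'), mvfderiv_metricFun_add g hZ hZ' hX,
      mvfderiv_metricFun_add g hZ hZ' hY, mlieBracket_add_left hZ hZ',
      mlieBracket_add_right hZ hZ', metricFun_comm g Y Z, metricFun_comm g Y Z']
    simp
    ring

theorem koszul_add {Y Y' X Z : Π x : M, TangentSpace I x} {x : M}
    (hY : MDiffAt (T% Y) x) (hY' : MDiffAt (T% Y') x)
    (hX : MDiffAt (T% X) x) (hZ : MDiffAt (T% Z) x) :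
    koszul g (Y + Y') X Z x = koszul g Y X Z x + koszul g Y' X Z x := by
  simp only [koszul, metricFun_comm g X (Y + Y'), mvfderiv_metricFun_add g hY hY' hX,
    mvfderiv_metricFun_add g hY hY' hZ, mlieBracket_add_left hY hY',
    mlieBracket_add_right hY hY', metricFun_comm g X Y, metricFun_comm g X Y']
  simp
  ring

theorem koszul_smul {Y X Z : Π x : M, TangentSpace I x} {f : M → ℝ} {x : M}
    (hf : MDiffAt f x) (hY : MDiffAt (T% Y) x)
    (hX : MDiffAt (T% X) x) (hZ : MDiffAt (T% Z) x) :
    koszul g (f • Y) X Z x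
      = f x * koszul g Y X Z x + 2 * (d% f x (X x) * g.inner x (Y x) (Z x)) := by
  simp only [koszul, metricFun_comm g X (f • Y), mvfderiv_metricFun_smul g hf hY hX,
    mvfderiv_metricFun_smul g hf hY hZ, mlieBracket_smul_left hf hY,
    mlieBracket_smul_right hf hY, metricFun_comm g X Y]
  simp [g.symm x (Y x)]
  ring

instance (x : M) : FiniteDimensional ℝ (TangentSpace I x) :=
  inferInstanceAs (FiniteDimensional ℝ E)

instance (x : M) : T2Space (TangentSpace I x) :=
  inferInstanceAs (T2Space E)

/-- The isomorphism `v ↦ g(v, ·)` between a tangent space and its dual. -/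
def flat (x : M) : TangentSpace I x ≃L[ℝ] (TangentSpace I x →L[ℝ] ℝ) :=
  have : FiniteDimensional ℝ (TangentSpace I x →L[ℝ] ℝ) :=
    Module.Finite.equiv (LinearMap.toContinuousLinearMap (𝕜 := ℝ) (E := TangentSpace I x)
      (F' := ℝ))
  (LinearEquiv.ofInjectiveOfFinrankEq (g.inner x).toLinearMap
    (by
      rw [injective_iff_map_eq_zero]
      intro v hv
      by_contra hne
      have := g.pos x v hne
      have h0 : g.inner x v v = 0 := by
        change (g.inner x).toLinearMap v v = 0
        rw [hv]; rfl
      exact this.ne' h0)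
    (by
      rw [← (LinearMap.toContinuousLinearMap (𝕜 := ℝ) (E := TangentSpace I x)
        (F' := ℝ)).finrank_eq]
      exact Subspace.dual_finrank_eq.symm)).toContinuousLinearEquiv

theorem flat_apply (x : M) (v w : TangentSpace I x) : flat g x v w = g.inner x v w := rfl

/-- The bilinear form `(X₀, Z₀) ↦ 2 g(∇_{X₀} Y, Z₀)` on the tangent space at `x`, given by the
Koszul formula if the vector field `Y` is differentiable at `x` (and `0` otherwise). -/
def koszulForm (Y : Π x : M, TangentSpace I x) (x : M) :
    TangentSpace I x →L[ℝ] TangentSpace I x →L[ℝ] ℝ :=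
  open Classical in
  if hY : MDiffAt (T% Y) x then
    TensorialAt.mkHom₂ (fun X Z ↦ koszul g Y X Z x) x
      (fun _ hZ ↦ koszul_tensorial_left g hY hZ) (fun _ hX ↦ koszul_tensorial_right g hY hX)
  else 0

theorem koszulForm_apply {Y X Z : Π x : M, TangentSpace I x} {x : M}
    (hY : MDiffAt (T% Y) x) (hX : MDiffAt (T% X) x) (hZ : MDiffAt (T% Z) x) :
    koszulForm g Y x (X x) (Z x) = koszul g Y X Z x := by
  rw [koszulForm, dif_pos hY]
  exact TensorialAt.mkHom₂_apply _ _ hX hZ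

/-- The value at `x` of `∇ Y` for the Levi-Civita connection `∇` of `g`, as the linear map
`X₀ ↦ ∇_{X₀} Y`. -/
def leviCivitaAt (Y : Π x : M, TangentSpace I x) (x : M) :
    TangentSpace I x →L[ℝ] TangentSpace I x :=
  (1 / 2 : ℝ) • ((flat g x).symm : (TangentSpace I x →L[ℝ] ℝ) →L[ℝ] TangentSpace I x).comp
    (koszulForm g Y x)

theorem inner_leviCivitaAt (Y : Π x : M, TangentSpace I x) (x : M) (u w : TangentSpace I x) :
    g.inner x (leviCivitaAt g Y x u) w = 1 / 2 * koszulForm g Y x u w := by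
  rw [← flat_apply]
  simp [leviCivitaAt]

/-- Koszul formula for the connection defined above. -/
theorem inner_leviCivitaAt_eq {Y X Z : Π x : M, TangentSpace I x} {x : M}
    (hY : MDiffAt (T% Y) x) (hX : MDiffAt (T% X) x) (hZ : MDiffAt (T% Z) x) :
    g.inner x (leviCivitaAt g Y x (X x)) (Z x) = 1 / 2 * koszul g Y X Z x := by
  rw [inner_leviCivitaAt, koszulForm_apply g hY hX hZ]

theorem ext_inner {x : M} {v v' : TangentSpace I x}
    (h : ∀ w, g.inner x v w = g.inner x v' w) : v = v' :=
  (flat g x).injective (ContinuousLinearMap.ext h)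

theorem ext_leviCivitaAt {x : M} {A B : TangentSpace I x →L[ℝ] TangentSpace I x}
    (h : ∀ X Z : Π x : M, TangentSpace I x, MDiffAt (T% X) x → MDiffAt (T% Z) x →
      g.inner x (A (X x)) (Z x) = g.inner x (B (X x)) (Z x)) : A = B := by
  ext u
  refine ext_inner g fun w ↦ ?_
  simpa using h (FiberBundle.extend E u) (FiberBundle.extend E w)
    (FiberBundle.mdifferentiableAt_extend ..) (FiberBundle.mdifferentiableAt_extend ..)

/-- The Levi-Civita connection of the Riemannian manifold `(M, g)`; `leviCivita g Y x (X x)` is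
`(∇_X Y)(x)`. -/
def leviCivita : CovariantDerivative I E (fun x : M ↦ TangentSpace I x) where
  toFun := leviCivitaAt g
  isCovariantDerivativeOnUniv :=
    { add := by
        intro Y Y' x hY hY' _
        refine ext_leviCivitaAt g fun X Z hX hZ ↦ ?_
        have hYY' : MDiffAt (T% (Y + Y')) x := mdifferentiableAt_add_section hY hY'
        simp only [inner_leviCivitaAt_eq g hYY' hX hZ, koszul_add g hY hY' hX hZ,
          add_apply, map_add, inner_leviCivitaAt_eq g hY hX hZ,
          inner_leviCivitaAt_eq g hY' hX hZ]
        ring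
      leibniz := by
        intro Y f x hY hf _
        refine ext_leviCivitaAt g fun X Z hX hZ ↦ ?_
        have hfY : MDiffAt (T% (f • Y)) x := hf.smul_section hY
        rw [inner_leviCivitaAt_eq g hfY hX hZ, koszul_smul g hf hY hX hZ]
        simp [inner_leviCivitaAt_eq g hY hX hZ]
        ring }

/-- The Levi-Civita connection is torsion-free. -/
theorem leviCivita_torsion {X Y : Π x : M, TangentSpace I x} {x : M}
    (hX : MDiffAt (T% X) x) (hY : MDiffAt (T% Y) x) :
    leviCivita g Y x (X x) - leviCivita g X x (Y x) = mlieBracket I X Y x := by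
  refine ext_inner g fun w ↦ ?_
  have hw : FiberBundle.extend E w x = w := by simp
  have hZ := FiberBundle.mdifferentiableAt_extend I E w
  generalize FiberBundle.extend E w = Z at hw hZ
  subst hw
  change g.inner x (leviCivitaAt g Y x (X x) - leviCivitaAt g X x (Y x)) (Z x) = _
  simp only [map_sub, sub_apply, inner_leviCivitaAt_eq g hY hX hZ,
    inner_leviCivitaAt_eq g hX hY hZ, koszul, metricFun_comm g Z, metricFun_comm g Y X,
    mlieBracket_swap_apply (V := Y) (W := X), mlieBracket_swap_apply (V := Z)]
  simp
  ring

/-- The Levi-Civita connection is compatible with the metric. -/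
theorem leviCivita_metric {X Y Z : Π x : M, TangentSpace I x} {x : M}
    (hX : MDiffAt (T% X) x) (hY : MDiffAt (T% Y) x) (hZ : MDiffAt (T% Z) x) :
    d% (metricFun g Y Z) x (X x)
      = g.inner x (leviCivita g Y x (X x)) (Z x) + g.inner x (Y x) (leviCivita g Z x (X x)) := by
  rw [g.symm x (Y x)]
  change _ = g.inner x (leviCivitaAt g Y x (X x)) (Z x) + g.inner x (leviCivitaAt g Z x (X x)) (Y x)
  simp only [inner_leviCivitaAt_eq g hY hX hZ, inner_leviCivitaAt_eq g hZ hX hY, koszul,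
    metricFun_comm g Z, metricFun_comm g Y X,
    mlieBracket_swap_apply (V := Y) (W := X), mlieBracket_swap_apply (V := Z)]
  simp
  ring

end LeviCivita

section Curvature

variable {E : Type*} [NormedAddCommGroup E] [NormedSpace ℝ E] [FiniteDimensional ℝ E]
  {H : Type*} [TopologicalSpace H] {I : ModelWithCorners ℝ E H}
  {M : Type*} [TopologicalSpace M] [ChartedSpace H M] [IsManifold I ∞ M]
  (g : ContMDiffRiemannianMetric I ∞ E (fun x : M ↦ TangentSpace I x))

/-- The covariant derivative `∇_X Y` of vector fields, for the Levi-Civita connection of `g`. -/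
def nabla (X Y : Π x : M, TangentSpace I x) : Π x : M, TangentSpace I x :=
  fun x ↦ leviCivita g Y x (X x)

/-- The Riemann curvature tensor `R(X, Y) Z = ∇_X ∇_Y Z - ∇_Y ∇_X Z - ∇_{[X, Y]} Z` of `g`. -/
def curvature (X Y Z : Π x : M, TangentSpace I x) : Π x : M, TangentSpace I x :=
  fun x ↦ nabla g X (nabla g Y Z) x - nabla g Y (nabla g X Z) x
    - nabla g (mlieBracket I X Y) Z x

end Curvature

/-- An almost contact metric structure `(φ, ξ, η, g)` on a smooth manifold `M`. -/
structure AlmostContactMetricStructure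
    {E : Type*} [NormedAddCommGroup E] [NormedSpace ℝ E] [FiniteDimensional ℝ E]
    {H : Type*} [TopologicalSpace H] (I : ModelWithCorners ℝ E H)
    (M : Type*) [TopologicalSpace M] [ChartedSpace H M] [IsManifold I ∞ M] where
  /-- the Riemannian metric -/
  g : ContMDiffRiemannianMetric I ∞ E (fun x : M ↦ TangentSpace I x)
  /-- the `(1,1)`-tensor field -/
  φ : Π x : M, TangentSpace I x →L[ℝ] TangentSpace I x
  /-- the structure vector field -/
  ξ : Π x : M, TangentSpace I x
  /-- the `1`-form -/
  η : Π x : M, TangentSpace I x →L[ℝ] ℝ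
  contMDiff_φ : ContMDiff I (I.prod 𝓘(ℝ, E →L[ℝ] E)) ∞
    (fun x ↦ TotalSpace.mk' (E →L[ℝ] E)
      (E := fun x : M ↦ TangentSpace I x →L[ℝ] TangentSpace I x) x (φ x))
  contMDiff_ξ : ContMDiff I I.tangent ∞ (fun x ↦ (⟨x, ξ x⟩ : TangentBundle I M))
  contMDiff_η : ContMDiff I (I.prod 𝓘(ℝ, E →L[ℝ] ℝ)) ∞
    (fun x ↦ TotalSpace.mk' (E →L[ℝ] ℝ) (E := fun x : M ↦ TangentSpace I x →L[ℝ] ℝ) x (η x))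
  η_ξ : ∀ x, η x (ξ x) = 1
  φ_φ : ∀ x (v : TangentSpace I x), φ x (φ x v) = -v + η x v • ξ x
  g_φ_φ : ∀ x (v w : TangentSpace I x),
    g.inner x (φ x v) (φ x w) = g.inner x v w - η x v * η x w

namespace AlmostContactMetricStructure

variable {E : Type*} [NormedAddCommGroup E] [NormedSpace ℝ E] [FiniteDimensional ℝ E]
  {H : Type*} [TopologicalSpace H] {I : ModelWithCorners ℝ E H}
  {M : Type*} [TopologicalSpace M] [ChartedSpace H M] [IsManifold I ∞ M]
  (S : AlmostContactMetricStructure I M)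

/-- The vector field `φ X`. -/
def phi (X : Π x : M, TangentSpace I x) : Π x : M, TangentSpace I x := fun x ↦ S.φ x (X x)

/-- The function `η(X)`. -/
def eta (X : Π x : M, TangentSpace I x) : M → ℝ := fun x ↦ S.η x (X x)

/-- The exterior derivative of `η`, in the convention
`dη(X, Y) = (X η(Y) - Y η(X) - η([X, Y])) / 2` usual in contact metric geometry. -/
def dEta (X Y : Π x : M, TangentSpace I x) (x : M) : ℝ :=
  1 / 2 * (d% (S.eta Y) x (X x) - d% (S.eta X) x (Y x) - S.η x (mlieBracket I X Y x))

/-- The tensor field `h`, defined by `2 h = L_ξ φ`, that is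
`2 h X = [ξ, φ X] - φ [ξ, X]`. -/
def h (X : Π x : M, TangentSpace I x) : Π x : M, TangentSpace I x :=
  fun x ↦ (1 / 2 : ℝ) • (mlieBracket I S.ξ (S.phi X) x - S.φ x (mlieBracket I S.ξ X x))

/-- The Nijenhuis torsion of `φ`,
`[φ, φ](X, Y) = φ² [X, Y] + [φ X, φ Y] - φ [φ X, Y] - φ [X, φ Y]`. -/
def nijenhuis (X Y : Π x : M, TangentSpace I x) : Π x : M, TangentSpace I x :=
  fun x ↦ S.φ x (S.φ x (mlieBracket I X Y x)) + mlieBracket I (S.phi X) (S.phi Y) x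
    - S.φ x (mlieBracket I (S.phi X) Y x) - S.φ x (mlieBracket I X (S.phi Y) x)

/-- `M` is a contact metric manifold: `dη = Φ`, where `Φ(X, Y) = g(X, φ Y)`. -/
def IsContactMetric : Prop :=
  ∀ X Y : Π x : M, TangentSpace I x,
    ContMDiff I I.tangent ∞ (fun x ↦ (⟨x, X x⟩ : TangentBundle I M)) →
    ContMDiff I I.tangent ∞ (fun x ↦ (⟨x, Y x⟩ : TangentBundle I M)) →
    ∀ x, S.dEta X Y x = S.g.inner x (X x) (S.φ x (Y x))

/-- The structure is normal: `[φ, φ] = -2 dη ⊗ ξ`. -/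
def IsNormal : Prop :=
  ∀ X Y : Π x : M, TangentSpace I x,
    ContMDiff I I.tangent ∞ (fun x ↦ (⟨x, X x⟩ : TangentBundle I M)) →
    ContMDiff I I.tangent ∞ (fun x ↦ (⟨x, Y x⟩ : TangentBundle I M)) →
    ∀ x, S.nijenhuis X Y x = (-2 * S.dEta X Y x) • S.ξ x

/-- `M` is a Sasakian manifold: a normal contact metric manifold. -/
def IsSasakian : Prop := S.IsContactMetric ∧ S.IsNormal

/-- `R₁(X, Y) Z = g(Y, Z) X - g(X, Z) Y`. -/
def R₁ (X Y Z : Π x : M, TangentSpace I x) : Π x : M, TangentSpace I x :=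
  fun x ↦ S.g.inner x (Y x) (Z x) • X x - S.g.inner x (X x) (Z x) • Y x

/-- `R₂(X, Y) Z = g(X, φ Z) φ Y - g(Y, φ Z) φ X + 2 g(X, φ Y) φ Z`. -/
def R₂ (X Y Z : Π x : M, TangentSpace I x) : Π x : M, TangentSpace I x :=
  fun x ↦ S.g.inner x (X x) (S.phi Z x) • S.phi Y x - S.g.inner x (Y x) (S.phi Z x) • S.phi X x
    + (2 * S.g.inner x (X x) (S.phi Y x)) • S.phi Z x

/-- `R₃(X, Y) Z = η(X) η(Z) Y - η(Y) η(Z) X + g(X, Z) η(Y) ξ - g(Y, Z) η(X) ξ`. -/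
def R₃ (X Y Z : Π x : M, TangentSpace I x) : Π x : M, TangentSpace I x :=
  fun x ↦ (S.eta X x * S.eta Z x) • Y x - (S.eta Y x * S.eta Z x) • X x
    + (S.g.inner x (X x) (Z x) * S.eta Y x) • S.ξ x
    - (S.g.inner x (Y x) (Z x) * S.eta X x) • S.ξ x

/-- `R₄(X, Y) Z = g(Y, Z) h X - g(X, Z) h Y + g(h Y, Z) X - g(h X, Z) Y`. -/
def R₄ (X Y Z : Π x : M, TangentSpace I x) : Π x : M, TangentSpace I x :=
  fun x ↦ S.g.inner x (Y x) (Z x) • S.h X x - S.g.inner x (X x) (Z x) • S.h Y x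
    + S.g.inner x (S.h Y x) (Z x) • X x - S.g.inner x (S.h X x) (Z x) • Y x

/-- `R₅(X, Y) Z = g(h Y, Z) h X - g(h X, Z) h Y + g(φ h X, Z) φ h Y - g(φ h Y, Z) φ h X`. -/
def R₅ (X Y Z : Π x : M, TangentSpace I x) : Π x : M, TangentSpace I x :=
  fun x ↦ S.g.inner x (S.h Y x) (Z x) • S.h X x - S.g.inner x (S.h X x) (Z x) • S.h Y x
    + S.g.inner x (S.phi (S.h X) x) (Z x) • S.phi (S.h Y) x
    - S.g.inner x (S.phi (S.h Y) x) (Z x) • S.phi (S.h X) x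

/-- `R₆(X, Y) Z = η(X) η(Z) h Y - η(Y) η(Z) h X + g(h X, Z) η(Y) ξ - g(h Y, Z) η(X) ξ`. -/
def R₆ (X Y Z : Π x : M, TangentSpace I x) : Π x : M, TangentSpace I x :=
  fun x ↦ (S.eta X x * S.eta Z x) • S.h Y x - (S.eta Y x * S.eta Z x) • S.h X x
    + (S.g.inner x (S.h X x) (Z x) * S.eta Y x) • S.ξ x
    - (S.g.inner x (S.h Y x) (Z x) * S.eta X x) • S.ξ x

/-- `M(f₁, …, f₆)` is a generalized `(κ, μ)`-space form: the functions `f₁, …, f₆` are smooth and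
`R = f₁ R₁ + f₂ R₂ + f₃ R₃ + f₄ R₄ + f₅ R₅ + f₆ R₆`. -/
def IsGeneralizedKappaMuSpaceForm (f₁ f₂ f₃ f₄ f₅ f₆ : M → ℝ) : Prop :=
  ContMDiff I 𝓘(ℝ, ℝ) ∞ f₁ ∧ ContMDiff I 𝓘(ℝ, ℝ) ∞ f₂ ∧ ContMDiff I 𝓘(ℝ, ℝ) ∞ f₃ ∧
  ContMDiff I 𝓘(ℝ, ℝ) ∞ f₄ ∧ ContMDiff I 𝓘(ℝ, ℝ) ∞ f₅ ∧ ContMDiff I 𝓘(ℝ, ℝ) ∞ f₆ ∧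
  ∀ X Y Z : Π x : M, TangentSpace I x,
    ContMDiff I I.tangent ∞ (fun x ↦ (⟨x, X x⟩ : TangentBundle I M)) →
    ContMDiff I I.tangent ∞ (fun x ↦ (⟨x, Y x⟩ : TangentBundle I M)) →
    ContMDiff I I.tangent ∞ (fun x ↦ (⟨x, Z x⟩ : TangentBundle I M)) →
    ∀ x, curvature S.g X Y Z x = f₁ x • S.R₁ X Y Z x + f₂ x • S.R₂ X Y Z x
      + f₃ x • S.R₃ X Y Z x + f₄ x • S.R₄ X Y Z x + f₅ x • S.R₅ X Y Z x + f₆ x • S.R₆ X Y Z x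

end AlmostContactMetricStructure

end AlmostContact

end

/-!
Write `∇_X ξ = -φ X + T X`. The contact condition `dη = Φ`, `Φ(X, Y) = g(X, φ Y)`, says that `T` is
symmetric; it also gives `L_ξ η = 0` and, since `Φ` is closed, `L_ξ Φ = 0`. From these,
`T ξ = 0`, `h = -T φ` and, after differentiating `φ² = -1 + η ⊗ ξ` along `ξ`, `T φ = -φ T` and
`∇_ξ φ = 0` (`IsContactMetric.h_eq`, `IsContactMetric.symmPart_φ`, `IsContactMetric.nabla_ξ_phi`).

The Jacobi operator `J X = R(X, ξ) ξ` of a contact metric manifold satisfies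
`φ J + J φ = 2 φ (1 - T²)` (`IsContactMetric.φ_curvature_add`). The space form hypothesis gives
`J = κ (1 - η ⊗ ξ) + μ h` with `κ = f₁ - f₃ = 1` and `μ = f₄ - f₆`, where `h` anticommutes with `φ`.
Comparing the two, `T² = 0`; as `T` is symmetric for a positive definite metric, `T = 0`
(`IsContactMetric.symmPart_eq_zero`), so `∇ξ = -φ` and `h = 0`.

Now `R(X, Y) ξ = η(Y) X - η(X) Y` reads `(∇_X φ) Y - (∇_Y φ) X = η(X) Y - η(Y) X`. Since `∇_X φ` is
skew-symmetric, `g((∇_X φ) Y, Z) - g(X, Y) η(Z) + η(Y) g(X, Z)` is symmetric in `X, Y` and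
skew-symmetric in `Y, Z`, hence zero. This is the formula `(∇_X φ) Y = g(X, Y) ξ - η(Y) X`
(`IsContactMetric.nablaPhi_eq`), and the Nijenhuis torsion of `φ`, expressed through `∇φ`, equals
`-2 Φ(X, Y) ξ`.

Apart from `∇` applied to given fields, only `∇_X ξ` has to be differentiated again; it is smooth
because `∇_X ξ = -φ X + h φ X` and `h` is made of Lie brackets. Smoothness of the Levi-Civita
connection itself is therefore never needed.
-/

namespace AlmostContact

/-! ### Smooth vector fields -/

section SmoothFields

variable {E : Type*} [NormedAddCommGroup E] [NormedSpace ℝ E]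
  {H : Type*} [TopologicalSpace H] {I : ModelWithCorners ℝ E H}
  {M : Type*} [TopologicalSpace M] [ChartedSpace H M] [IsManifold I ∞ M]

/-- `X` is a smooth vector field on `M`. -/
def SmoothField (X : Π x : M, TangentSpace I x) : Prop :=
  ContMDiff I I.tangent ∞ (fun x ↦ (⟨x, X x⟩ : TangentBundle I M))

namespace SmoothField

variable {X Y Z : Π x : M, TangentSpace I x} {f : M → ℝ}

theorem mdiffAt (hX : SmoothField X) (x : M) : MDiffAt (T% X) x :=
  (ContMDiff.mdifferentiable hX (by simp)) x

theorem add (hX : SmoothField X) (hY : SmoothField Y) : SmoothField (X + Y) :=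
  ContMDiff.add_section hX hY

theorem sub (hX : SmoothField X) (hY : SmoothField Y) : SmoothField (X - Y) :=
  ContMDiff.sub_section hX hY

theorem neg (hX : SmoothField X) : SmoothField (-X) :=
  ContMDiff.neg_section hX

theorem smul (hf : ContMDiff I 𝓘(ℝ, ℝ) ∞ f) (hX : SmoothField X) : SmoothField (f • X) :=
  ContMDiff.smul_section hf hX

theorem const_smul (c : ℝ) (hX : SmoothField X) : SmoothField (c • X) :=
  ContMDiff.const_smul_section hX

theorem mlieBracket [CompleteSpace E] (hX : SmoothField X) (hY : SmoothField Y) :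
    SmoothField (mlieBracket I X Y) := by
  have : IsManifold I (minSmoothness ℝ 2) M := .of_le (n := ∞) (by simpa using ENat.LEInfty.out)
  have : IsManifold I ((⊤ : ℕ∞) + 1) M := by simpa using! ‹IsManifold I ∞ M›
  exact ContDiff.mlieBracket_vectorField (m := ⊤) (n := ⊤) hX hY (by simp)

/-- The derivative `X f` of a smooth function along a smooth vector field is smooth. -/
theorem mvfderiv (hX : SmoothField X) (hf : ContMDiff I 𝓘(ℝ, ℝ) ∞ f) :
    ContMDiff I 𝓘(ℝ, ℝ) ∞ (fun x ↦ d% f x (X x)) := by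
  have h := hf.contMDiff_tangentMap (m := ∞) (by simp)
  exact ((contMDiff_snd_tangentBundle_modelSpace ℝ 𝓘(ℝ, ℝ)).comp h).comp hX

theorem jacobi [CompleteSpace E] (hX : SmoothField X) (hY : SmoothField Y) (hZ : SmoothField Z)
    (x : M) :
    VectorField.mlieBracket I X (VectorField.mlieBracket I Y Z) x
      = VectorField.mlieBracket I (VectorField.mlieBracket I X Y) Z x
        + VectorField.mlieBracket I Y (VectorField.mlieBracket I X Z) x := by
  have : IsManifold I (minSmoothness ℝ 3) M := .of_le (n := ∞) (by simpa using ENat.LEInfty.out)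
  have h2 : minSmoothness ℝ 2 ≤ ∞ := by simpa using ENat.LEInfty.out
  exact leibniz_identity_mlieBracket_apply ((hX x).of_le h2) ((hY x).of_le h2) ((hZ x).of_le h2)

/-- The commutator formula `[X, Y] f = X (Y f) - Y (X f)`. It is read off from the coefficient of
`Z` in the Jacobi identity for `X`, `Y` and `f Z`. -/
theorem mvfderiv_mlieBracket [CompleteSpace E] (hX : SmoothField X) (hY : SmoothField Y)
    (hf : ContMDiff I 𝓘(ℝ, ℝ) ∞ f) (hZ : SmoothField Z) {x : M} (hx : Z x ≠ 0) :
    d% f x (VectorField.mlieBracket I X Y x)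
      = d% (fun y ↦ d% f y (Y y)) x (X x) - d% (fun y ↦ d% f y (X y)) x (Y x) := by
  have hfd : ∀ y, MDiffAt f y := fun y ↦ hf.mdifferentiable (by simp) y
  have key : ∀ {V : Π x : M, TangentSpace I x}, SmoothField V →
      VectorField.mlieBracket I V (f • Z)
        = (fun y ↦ d% f y (V y)) • Z + f • VectorField.mlieBracket I V Z := by
    intro V hV
    ext1 y
    simp [mlieBracket_smul_right (hfd y) (hZ.mdiffAt y)]
  have key2 : ∀ {V W : Π x : M, TangentSpace I x}, SmoothField V → SmoothField W →
      VectorField.mlieBracket I V (VectorField.mlieBracket I W (f • Z)) x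
        = d% (fun y ↦ d% f y (W y)) x (V x) • Z x + d% f x (W x) • VectorField.mlieBracket I V Z x
          + (d% f x (V x) • VectorField.mlieBracket I W Z x
          + f x • VectorField.mlieBracket I V (VectorField.mlieBracket I W Z) x) := by
    intro V W hV hW
    have hg := hW.mvfderiv hf
    rw [key hW, mlieBracket_add_right ((hZ.smul hg).mdiffAt x)
      (((hW.mlieBracket hZ).smul hf).mdiffAt x),
      mlieBracket_smul_right (hg.mdifferentiable (by simp) x) (hZ.mdiffAt x),
      mlieBracket_smul_right (hfd x) ((hW.mlieBracket hZ).mdiffAt x)]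
  have h := jacobi hX hY (hZ.smul hf) x
  rw [key2 hX hY, key2 hY hX, key (hX.mlieBracket hY), jacobi hX hY hZ x] at h
  simp only [Pi.add_apply, Pi.smul_apply', smul_add] at h
  have h' : (d% f x (VectorField.mlieBracket I X Y x)
      - (d% (fun y ↦ d% f y (Y y)) x (X x) - d% (fun y ↦ d% f y (X y)) x (Y x))) • Z x = 0 := by
    rw [← sub_eq_zero] at h
    rw [← neg_eq_zero, ← h]
    module
  exact sub_eq_zero.1 ((smul_eq_zero.1 h').resolve_right hx)

end SmoothField

/-- Every tangent vector is the value of a globally defined smooth vector field. -/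
theorem exists_smoothField [FiniteDimensional ℝ E] [T2Space M] {x : M} (v : TangentSpace I x) :
    ∃ X : Π x : M, TangentSpace I x, SmoothField X ∧ X x = v := by
  obtain ⟨s, hs, hsm⟩ := FiberBundle.exists_contMDiffOn_extend (k := ∞) I E v
  obtain ⟨u, hus, hu, hxu⟩ := mem_nhds_iff.1 hs
  obtain ⟨ψ, hψ⟩ := (SmoothBumpFunction.nhds_basis_tsupport (I := I) x).mem_iff.1
    (hu.mem_nhds hxu)
  refine ⟨(ψ : M → ℝ) • FiberBundle.extend E v, ?_, by simp⟩
  exact ContMDiffOn.smul_section_of_tsupport ψ.contMDiff.contMDiffOn hu hψ.2 (hsm.mono hus)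

end SmoothFields

/-! ### The Levi-Civita connection on smooth vector fields -/

section LeviCivita

variable {E : Type*} [NormedAddCommGroup E] [NormedSpace ℝ E] [FiniteDimensional ℝ E]
  {H : Type*} [TopologicalSpace H] {I : ModelWithCorners ℝ E H}
  {M : Type*} [TopologicalSpace M] [ChartedSpace H M] [IsManifold I ∞ M]
  (g : ContMDiffRiemannianMetric I ∞ E (fun x : M ↦ TangentSpace I x))
  {X Y Z : Π x : M, TangentSpace I x} {f : M → ℝ}

theorem nabla_add (hY : SmoothField Y) (hZ : SmoothField Z) (x : M) :
    nabla g X (Y + Z) x = nabla g X Y x + nabla g X Z x := by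
  simp [nabla, (leviCivita g).isCovariantDerivativeOnUniv.add (hY.mdiffAt x) (hZ.mdiffAt x)]

theorem nabla_const_smul (c : ℝ) (hY : SmoothField Y) (x : M) :
    nabla g X (c • Y) x = c • nabla g X Y x := by
  simp [nabla, (leviCivita g).isCovariantDerivativeOnUniv.smul_const c (hY.mdiffAt x)]

theorem nabla_neg (hY : SmoothField Y) (x : M) : nabla g X (-Y) x = -nabla g X Y x := by
  simpa using nabla_const_smul g (X := X) (-1) hY x

theorem nabla_smul (hf : ContMDiff I 𝓘(ℝ, ℝ) ∞ f) (hY : SmoothField Y) (x : M) :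
    nabla g X (f • Y) x = f x • nabla g X Y x + d% f x (X x) • Y x := by
  simp [nabla, (leviCivita g).isCovariantDerivativeOnUniv.leibniz (hY.mdiffAt x)
    (hf.mdifferentiable (by simp) x)]

theorem nabla_zero : nabla g X 0 = 0 := by
  ext1 x
  simp [nabla]

theorem mlieBracket_eq_nabla_sub (hX : SmoothField X) (hY : SmoothField Y) (x : M) :
    mlieBracket I X Y x = nabla g X Y x - nabla g Y X x :=
  (leviCivita_torsion g (hX.mdiffAt x) (hY.mdiffAt x)).symm

theorem mvfderiv_inner_eq (hX : SmoothField X) (hY : SmoothField Y) (hZ : SmoothField Z) (x : M) :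
    d% (metricFun g Y Z) x (X x)
      = g.inner x (nabla g X Y x) (Z x) + g.inner x (Y x) (nabla g X Z x) :=
  leviCivita_metric g (hX.mdiffAt x) (hY.mdiffAt x) (hZ.mdiffAt x)

end LeviCivita

namespace AlmostContactMetricStructure

/-! ### Algebra of an almost contact metric structure -/

section Pointwise

variable {E : Type*} [NormedAddCommGroup E] [NormedSpace ℝ E] [FiniteDimensional ℝ E]
  {H : Type*} [TopologicalSpace H] {I : ModelWithCorners ℝ E H}
  {M : Type*} [TopologicalSpace M] [ChartedSpace H M] [IsManifold I ∞ M]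
  (S : AlmostContactMetricStructure I M) (x : M)

theorem ξ_ne_zero : S.ξ x ≠ 0 := fun h ↦ by simpa [h] using S.η_ξ x

/-- As `φ² ξ = 0`, computing `φ³ ξ` in two ways shows that `φ ξ` is a multiple `c ξ` of `ξ`; then
`0 = φ² ξ = c² ξ`. -/
theorem φ_ξ : S.φ x (S.ξ x) = 0 := by
  have h2 : S.φ x (S.φ x (S.ξ x)) = 0 := by simp [S.φ_φ, S.η_ξ]
  have h3 : S.φ x (S.ξ x) = S.η x (S.φ x (S.ξ x)) • S.ξ x := by
    have h := S.φ_φ x (S.φ x (S.ξ x))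
    rw [h2, map_zero] at h
    exact (neg_add_eq_zero.1 h.symm)
  have h4 : S.η x (S.φ x (S.ξ x)) • S.φ x (S.ξ x) = 0 := by
    rw [← map_smul, ← h3, h2]
  rcases smul_eq_zero.1 h4 with h | h
  · rw [h3, h, zero_smul]
  · exact h

/-- Compute `φ³` as `φ ∘ φ²` and as `φ² ∘ φ`. -/
theorem η_φ (v : TangentSpace I x) : S.η x (S.φ x v) = 0 := by
  have h := S.φ_φ x (S.φ x v)
  rw [S.φ_φ x v, map_add, map_neg, map_smul, S.φ_ξ, smul_zero, add_zero, left_eq_add] at h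
  exact (smul_eq_zero.1 h).resolve_right (S.ξ_ne_zero x)

theorem inner_ξ (v : TangentSpace I x) : S.g.inner x v (S.ξ x) = S.η x v := by
  have h := S.g_φ_φ x v (S.ξ x)
  rw [S.φ_ξ, map_zero, S.η_ξ, mul_one] at h
  linarith

theorem inner_ξ_left (v : TangentSpace I x) : S.g.inner x (S.ξ x) v = S.η x v := by
  rw [S.g.symm, S.inner_ξ]

theorem inner_φ_left (v w : TangentSpace I x) :
    S.g.inner x (S.φ x v) w = -S.g.inner x v (S.φ x w) := by
  have h := S.g_φ_φ x (S.φ x v) w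
  rw [S.φ_φ, S.η_φ, map_add, map_neg, map_smul] at h
  simp only [add_apply, neg_apply, smul_apply, S.inner_ξ_left, S.η_φ] at h
  simp only [smul_eq_mul, mul_zero, add_zero, zero_mul, sub_zero] at h
  exact h.symm

end Pointwise

/-! ### Smoothness and the covariant derivative of `ξ` -/

section Smooth

variable {E : Type*} [NormedAddCommGroup E] [NormedSpace ℝ E] [FiniteDimensional ℝ E]
  {H : Type*} [TopologicalSpace H] {I : ModelWithCorners ℝ E H}
  {M : Type*} [TopologicalSpace M] [ChartedSpace H M] [IsManifold I ∞ M]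
  (S : AlmostContactMetricStructure I M) {X Y Z : Π x : M, TangentSpace I x}

theorem smooth_ξ : SmoothField S.ξ := S.contMDiff_ξ

theorem smooth_phi (hX : SmoothField X) : SmoothField (S.phi X) :=
  ContMDiff.clm_bundle_apply S.contMDiff_φ hX

theorem smooth_eta (hX : SmoothField X) : ContMDiff I 𝓘(ℝ, ℝ) ∞ (S.eta X) := by
  have h : ContMDiff I (I.prod 𝓘(ℝ, ℝ)) ∞
      (fun m ↦ TotalSpace.mk' ℝ (E := Bundle.Trivial M ℝ) m (S.η m (X m))) :=
    ContMDiff.clm_bundle_apply (F₁ := E) S.contMDiff_η hX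
  intro x
  exact ((contMDiffAt_totalSpace).1 (h x)).2

theorem smooth_h (hX : SmoothField X) : SmoothField (S.h X) :=
  ((S.smooth_ξ.mlieBracket (S.smooth_phi hX)).sub
    (S.smooth_phi (S.smooth_ξ.mlieBracket hX))).const_smul (1 / 2)

theorem eta_eq_metricFun (X : Π x : M, TangentSpace I x) : S.eta X = metricFun S.g S.ξ X := by
  ext x
  exact (S.inner_ξ_left x _).symm

theorem eta_ξ : S.eta S.ξ = fun _ ↦ 1 := funext S.η_ξ

/-- The derivative `v ↦ ∇_v ξ` of the structure vector field, as an endomorphism of the tangent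
space at `x`. -/
noncomputable def nablaXi (x : M) : TangentSpace I x →L[ℝ] TangentSpace I x :=
  leviCivita S.g S.ξ x

theorem nabla_ξ (X : Π x : M, TangentSpace I x) (x : M) :
    nabla S.g X S.ξ x = S.nablaXi x (X x) := rfl

/-- `∇_ξ X = [ξ, X] + ∇_X ξ`. -/
theorem nabla_ξ_left (hX : SmoothField X) (x : M) :
    nabla S.g S.ξ X x = mlieBracket I S.ξ X x + S.nablaXi x (X x) := by
  rw [mlieBracket_eq_nabla_sub S.g S.smooth_ξ hX, S.nabla_ξ, sub_add_cancel]

theorem two_smul_h (X : Π x : M, TangentSpace I x) (x : M) :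
    (2 : ℝ) • S.h X x = mlieBracket I S.ξ (S.phi X) x - S.φ x (mlieBracket I S.ξ X x) := by
  simp [h, smul_smul]

theorem mvfderiv_eta (hX : SmoothField X) (hY : SmoothField Y) (x : M) :
    d% (S.eta Y) x (X x) = S.g.inner x (S.nablaXi x (X x)) (Y x) + S.η x (nabla S.g X Y x) := by
  rw [eta_eq_metricFun, mvfderiv_inner_eq S.g hX S.smooth_ξ hY, S.nabla_ξ, S.inner_ξ_left]

/-- `2 dη(X, Y) = g(∇_X ξ, Y) - g(∇_Y ξ, X)`. -/
theorem dEta_eq (hX : SmoothField X) (hY : SmoothField Y) (x : M) :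
    2 * S.dEta X Y x
      = S.g.inner x (S.nablaXi x (X x)) (Y x) - S.g.inner x (S.nablaXi x (Y x)) (X x) := by
  rw [dEta, S.mvfderiv_eta hX hY, S.mvfderiv_eta hY hX, mlieBracket_eq_nabla_sub S.g hX hY, map_sub]
  ring

/-- `∇ξ` takes values in the orthogonal complement of `ξ`, a unit vector field. -/
theorem η_nablaXi [T2Space M] (x : M) (v : TangentSpace I x) : S.η x (S.nablaXi x v) = 0 := by
  obtain ⟨X, hX, rfl⟩ := exists_smoothField v
  have h := S.mvfderiv_eta hX S.smooth_ξ x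
  rw [S.eta_ξ, mvfderiv_const, S.nabla_ξ, S.inner_ξ] at h
  simp only [zero_apply] at h
  linarith

end Smooth

/-! ### Contact metric manifolds -/

section Contact

variable {E : Type*} [NormedAddCommGroup E] [NormedSpace ℝ E] [FiniteDimensional ℝ E]
  {H : Type*} [TopologicalSpace H] {I : ModelWithCorners ℝ E H}
  {M : Type*} [TopologicalSpace M] [ChartedSpace H M] [IsManifold I ∞ M]
  (S : AlmostContactMetricStructure I M) {X Y Z : Π x : M, TangentSpace I x}

/-- The tensor field `T = ∇ξ + φ`. On a contact metric manifold it is the symmetric part of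
`∇ξ`, so that `2 g(T ·, ·) = L_ξ g`, and `h = -T φ`. -/
noncomputable def symmPart (x : M) : TangentSpace I x →L[ℝ] TangentSpace I x :=
  S.nablaXi x + S.φ x

theorem nablaXi_eq_symmPart_sub (x : M) (v : TangentSpace I x) :
    S.nablaXi x v = S.symmPart x v - S.φ x v := by
  simp [symmPart]

theorem η_symmPart [T2Space M] (x : M) (v : TangentSpace I x) : S.η x (S.symmPart x v) = 0 := by
  simp [symmPart, S.η_nablaXi, S.η_φ]

namespace IsContactMetric

variable {S} (hc : S.IsContactMetric)
include hc

/-- `L_ξ η = 0`. -/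
theorem mvfderiv_eta_ξ (hY : SmoothField Y) (x : M) :
    d% (S.eta Y) x (S.ξ x) = S.η x (mlieBracket I S.ξ Y x) := by
  have h := hc S.ξ Y S.smooth_ξ hY x
  rw [dEta, S.inner_ξ_left, S.η_φ, S.eta_ξ, mvfderiv_const] at h
  simp only [zero_apply] at h
  linarith

/-- `L_ξ Φ = 0` for `Φ(X, Y) = g(X, φ Y)`. This is the closedness of `Φ = dη` contracted with
`ξ`, combined with `dη(ξ, ·) = 0`. -/
theorem mvfderiv_metricFun_phi_ξ (hX : SmoothField X) (hY : SmoothField Y) (x : M) :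
    d% (metricFun S.g X (S.phi Y)) x (S.ξ x)
      = S.g.inner x (mlieBracket I S.ξ X x) (S.φ x (Y x))
        + S.g.inner x (X x) (S.φ x (mlieBracket I S.ξ Y x)) := by
  have hXY := hX.mlieBracket hY
  have hξX := S.smooth_ξ.mlieBracket hX
  have hξY := S.smooth_ξ.mlieBracket hY
  have e : ∀ {V : Π x : M, TangentSpace I x}, SmoothField V →
      (fun y ↦ d% (S.eta V) y (S.ξ y)) = S.eta (mlieBracket I S.ξ V) := fun hV ↦
    funext fun y ↦ hc.mvfderiv_eta_ξ hV y
  have d : ∀ {f : M → ℝ}, ContMDiff I 𝓘(ℝ, ℝ) ∞ f → MDiffAt f x := fun hf ↦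
    hf.mdifferentiable (by simp) x
  have hΦ : metricFun S.g X (S.phi Y) + metricFun S.g X (S.phi Y)
      = (fun y ↦ d% (S.eta Y) y (X y)) - (fun y ↦ d% (S.eta X) y (Y y))
        - S.eta (mlieBracket I X Y) := by
    ext y
    have h : metricFun S.g X (S.phi Y) y = S.dEta X Y y := (hc X Y hX hY y).symm
    simp only [Pi.add_apply, Pi.sub_apply, h, dEta, eta]
    ring
  have hm : MDiffAt (metricFun S.g X (S.phi Y)) x :=
    mdifferentiableAt_metricFun S.g (hX.mdiffAt x) ((S.smooth_phi hY).mdiffAt x)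
  have da := hX.mvfderiv (S.smooth_eta hY)
  have db := hY.mvfderiv (S.smooth_eta hX)
  have e1 : d% (metricFun S.g X (S.phi Y) + metricFun S.g X (S.phi Y)) x
      = d% (fun y ↦ d% (S.eta Y) y (X y)) x - d% (fun y ↦ d% (S.eta X) y (Y y)) x
        - d% (S.eta (mlieBracket I X Y)) x := by
    rw [hΦ, ← mvfderiv_sub (d da) (d db)]
    exact mvfderiv_sub (d (da.sub db)) (d (S.smooth_eta hXY))
  rw [mvfderiv_add hm hm] at e1
  have h := congrArg (fun L ↦ L (S.ξ x)) e1
  simp only [add_apply, sub_apply] at h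
  rw [hc.mvfderiv_eta_ξ hXY] at h
  -- the commutator formula turns derivatives along `ξ` of derivatives along `X`, `Y` into
  -- derivatives along `[ξ, X]`, `[ξ, Y]`
  have c1 := S.smooth_ξ.mvfderiv_mlieBracket hX (S.smooth_eta hY) S.smooth_ξ (S.ξ_ne_zero x)
  have c2 := S.smooth_ξ.mvfderiv_mlieBracket hY (S.smooth_eta hX) S.smooth_ξ (S.ξ_ne_zero x)
  rw [e hY] at c1
  rw [e hX] at c2
  have j := congrArg (S.η x) (SmoothField.jacobi S.smooth_ξ hX hY x)
  rw [map_add] at j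
  have h1 := hc _ _ hξX hY x
  have h2 := hc _ _ hX hξY x
  rw [dEta] at h1 h2
  rw [← h1, ← h2]
  linarith

variable [T2Space M]

/-- The skew part of `∇ξ` is `-φ`. -/
theorem inner_nablaXi_sub (x : M) (v w : TangentSpace I x) :
    S.g.inner x (S.nablaXi x v) w - S.g.inner x (S.nablaXi x w) v
      = 2 * S.g.inner x v (S.φ x w) := by
  obtain ⟨X, hX, rfl⟩ := exists_smoothField v
  obtain ⟨Y, hY, rfl⟩ := exists_smoothField w
  rw [← S.dEta_eq hX hY, hc X Y hX hY]

/-- The integral curves of `ξ` are geodesics. -/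
theorem nablaXi_ξ (x : M) : S.nablaXi x (S.ξ x) = 0 := by
  refine ext_inner S.g fun w ↦ ?_
  have h := hc.inner_nablaXi_sub x w (S.ξ x)
  rw [S.inner_ξ, S.η_nablaXi, S.φ_ξ, map_zero] at h
  rw [map_zero, zero_apply]
  linarith

/-- As `L_ξ Φ = 0`, the product rule for
`Φ(X, Y) = g(X, φ Y)` gives `(L_ξ g)(X, φ Y) = -2 g(X, h Y)`, while `dη = Φ` determines the
skew part of `∇ξ`. -/
theorem nablaXi_φ (hY : SmoothField Y) (x : M) :
    S.nablaXi x (S.φ x (Y x)) = -S.φ x (S.φ x (Y x)) - S.h Y x := by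
  refine ext_inner S.g fun w ↦ ?_
  obtain ⟨X, hX, rfl⟩ := exists_smoothField w
  have h1 := mvfderiv_inner_eq S.g S.smooth_ξ hX (S.smooth_phi hY) x
  rw [hc.mvfderiv_metricFun_phi_ξ hX hY, S.nabla_ξ_left hX, S.nabla_ξ_left (S.smooth_phi hY)] at h1
  have h2 := congrArg (S.g.inner x (X x)) (S.two_smul_h Y x)
  have h3 := hc.inner_nablaXi_sub x (X x) (S.φ x (Y x))
  simp only [map_add, map_sub, map_smul, add_apply, smul_eq_mul, phi] at h1 h2
  simp only [map_sub, map_neg, sub_apply, neg_apply]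
  rw [S.g.symm x (S.h Y x), S.g.symm x (S.φ x (S.φ x (Y x)))]
  have h4 := S.g.symm x (S.nablaXi x (S.φ x (Y x))) (X x)
  linarith

theorem h_eq (hY : SmoothField Y) (x : M) : S.h Y x = -S.symmPart x (S.φ x (Y x)) := by
  have h := hc.nablaXi_φ hY x
  rw [nablaXi_eq_symmPart_sub] at h
  rw [eq_neg_iff_add_eq_zero, ← sub_eq_zero.2 h]
  abel

theorem symmPart_ξ (x : M) : S.symmPart x (S.ξ x) = 0 := by
  simp [symmPart, hc.nablaXi_ξ, S.φ_ξ]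

theorem symmPart_symm (x : M) (v w : TangentSpace I x) :
    S.g.inner x (S.symmPart x v) w = S.g.inner x v (S.symmPart x w) := by
  have h := hc.inner_nablaXi_sub x v w
  have h2 := S.inner_φ_left x v w
  rw [S.g.symm x (S.nablaXi x w)] at h
  simp only [symmPart, add_apply, map_add]
  linarith

theorem symmPart_φ_φ (x : M) (v : TangentSpace I x) :
    S.symmPart x (S.φ x (S.φ x v)) = -S.symmPart x v := by
  rw [S.φ_φ, map_add, map_neg, map_smul, hc.symmPart_ξ, smul_zero, add_zero]

/-- `∇ξ = -φ + h φ`, so that `∇_X ξ` is a smooth vector field for every smooth `X`. -/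
theorem smooth_nablaXi (hX : SmoothField X) :
    SmoothField (fun x ↦ S.nablaXi x (X x)) := by
  have h : (fun x ↦ S.nablaXi x (X x)) = S.h (S.phi X) - S.phi X := by
    ext1 x
    rw [Pi.sub_apply, hc.h_eq (S.smooth_phi hX), nablaXi_eq_symmPart_sub, phi, symmPart_φ_φ hc,
      neg_neg]
  rw [h]
  exact (S.smooth_h (S.smooth_phi hX)).sub (S.smooth_phi hX)

/-- `∇_ξ φ = -(T φ + φ T)`. -/
theorem nabla_ξ_phi_eq_sub (hY : SmoothField Y) (x : M) :
    nabla S.g S.ξ (S.phi Y) x = S.φ x (nabla S.g S.ξ Y x)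
      - (S.symmPart x (S.φ x (Y x)) + S.φ x (S.symmPart x (Y x))) := by
  have h := S.two_smul_h Y x
  rw [hc.h_eq hY] at h
  rw [S.nabla_ξ_left hY, S.nabla_ξ_left (S.smooth_phi hY), phi, nablaXi_eq_symmPart_sub,
    nablaXi_eq_symmPart_sub, map_add, map_sub, ← sub_eq_zero]
  rw [← sub_eq_zero] at h
  rw [← neg_eq_zero, ← h]
  module

/-- `T` anticommutes with `φ`. Comparing the derivatives along `ξ` of the two sides of
`φ² = -1 + η ⊗ ξ` shows that `∇_ξ φ = -(T φ + φ T)` anticommutes with `φ`. -/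
theorem symmPart_φ (x : M) (v : TangentSpace I x) :
    S.symmPart x (S.φ x v) = -S.φ x (S.symmPart x v) := by
  obtain ⟨Y, hY, rfl⟩ := exists_smoothField v
  have hφY := S.smooth_phi hY
  have h1 := hc.nabla_ξ_phi_eq_sub hφY x
  rw [hc.nabla_ξ_phi_eq_sub hY] at h1
  have h2 : S.phi (S.phi Y) = -Y + S.eta Y • S.ξ := by
    ext1 y
    exact S.φ_φ y (Y y)
  have h3 : S.η x (nabla S.g S.ξ Y x) = S.η x (mlieBracket I S.ξ Y x) := by
    rw [S.nabla_ξ_left hY, map_add, S.η_nablaXi, add_zero]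
  rw [h2, nabla_add S.g hY.neg (S.smooth_ξ.smul (S.smooth_eta hY)), nabla_neg S.g hY,
    nabla_smul S.g (S.smooth_eta hY) S.smooth_ξ, S.nabla_ξ, hc.nablaXi_ξ, hc.mvfderiv_eta_ξ hY,
    ← h3] at h1
  simp only [phi, map_sub, map_add, S.φ_φ, hc.symmPart_ξ, map_neg, map_smul, smul_zero,
    η_symmPart, zero_smul, add_zero] at h1
  have h4 : S.φ x (S.symmPart x (S.φ x (Y x))) = S.symmPart x (Y x) := by
    have h5 : (2 : ℝ) • (S.φ x (S.symmPart x (S.φ x (Y x))) - S.symmPart x (Y x)) = 0 := by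
      rw [← sub_eq_zero] at h1
      rw [← h1]
      module
    exact sub_eq_zero.1 ((smul_eq_zero.1 h5).resolve_left two_ne_zero)
  rw [← h4, S.φ_φ, η_symmPart, zero_smul, add_zero, neg_neg]

/-- `∇_ξ φ = 0`. -/
theorem nabla_ξ_phi (hY : SmoothField Y) (x : M) :
    nabla S.g S.ξ (S.phi Y) x = S.φ x (nabla S.g S.ξ Y x) := by
  rw [hc.nabla_ξ_phi_eq_sub hY, hc.symmPart_φ, neg_add_cancel, sub_zero]

end IsContactMetric

end Contact

/-! ### Curvature and vanishing of `T` -/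

section Curvature

variable {E : Type*} [NormedAddCommGroup E] [NormedSpace ℝ E] [FiniteDimensional ℝ E]
  {H : Type*} [TopologicalSpace H] {I : ModelWithCorners ℝ E H}
  {M : Type*} [TopologicalSpace M] [ChartedSpace H M] [IsManifold I ∞ M]
  {S : AlmostContactMetricStructure I M} {X Y Z : Π x : M, TangentSpace I x}

namespace IsContactMetric

variable [T2Space M] (hc : S.IsContactMetric)
include hc

/-- The Jacobi operator of `ξ`: `R(X, ξ) ξ = -∇_ξ (∇_X ξ) - ∇_{[X, ξ]} ξ`, as `∇_ξ ξ = 0`. -/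
theorem curvature_ξ_ξ (hX : SmoothField X) (x : M) :
    curvature S.g X S.ξ S.ξ x = -nabla S.g S.ξ (fun y ↦ S.nablaXi y (X y)) x
      - S.nablaXi x (S.nablaXi x (X x) - nabla S.g S.ξ X x) := by
  have h0 : nabla S.g S.ξ S.ξ = 0 := funext fun y ↦ hc.nablaXi_ξ y
  rw [curvature, h0, nabla_zero, Pi.zero_apply, zero_sub, S.nabla_ξ (mlieBracket I X S.ξ),
    mlieBracket_eq_nabla_sub S.g hX S.smooth_ξ]
  rfl

theorem nablaXi_nablaXi (x : M) (v : TangentSpace I x) :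
    S.nablaXi x (S.nablaXi x v) = S.symmPart x (S.symmPart x v) + S.φ x (S.φ x v) := by
  simp only [nablaXi_eq_symmPart_sub, map_sub, hc.symmPart_φ]
  abel

/-- `φ (∇_v ξ) + ∇_{φ v} ξ = -2 φ² v`. -/
theorem φ_nablaXi_add (x : M) (v : TangentSpace I x) :
    S.φ x (S.nablaXi x v) + S.nablaXi x (S.φ x v) = (-2 : ℝ) • S.φ x (S.φ x v) := by
  simp only [nablaXi_eq_symmPart_sub, map_sub, hc.symmPart_φ]
  module

/-- The part of the Jacobi operator of `ξ` commuting with `φ` is `1 - η ⊗ ξ - T²`. -/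
theorem φ_curvature_add (hX : SmoothField X) (x : M) :
    S.φ x (curvature S.g X S.ξ S.ξ x) + curvature S.g (S.phi X) S.ξ S.ξ x
      = (2 : ℝ) • (S.φ x (X x) - S.φ x (S.symmPart x (S.symmPart x (X x)))) := by
  have hφX := S.smooth_phi hX
  have hBX := hc.smooth_nablaXi hX
  have hBφX := hc.smooth_nablaXi hφX
  have hsum : S.phi (fun y ↦ S.nablaXi y (X y)) + (fun y ↦ S.nablaXi y (S.phi X y))
      = (-2 : ℝ) • S.phi (S.phi X) :=
    funext fun y ↦ hc.φ_nablaXi_add y (X y)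
  have hD := congrArg (fun V ↦ nabla S.g S.ξ V x) hsum
  simp only [nabla_add S.g (S.smooth_phi hBX) hBφX, nabla_const_smul S.g _ (S.smooth_phi hφX),
    hc.nabla_ξ_phi hφX, hc.nabla_ξ_phi hX, hc.nabla_ξ_phi hBX] at hD
  have h1 := hc.φ_nablaXi_add x (nabla S.g S.ξ X x)
  have h3 : S.φ x (S.φ x (S.φ x (X x))) = -S.φ x (X x) := by
    rw [S.φ_φ, S.η_φ, zero_smul, add_zero]
  rw [hc.curvature_ξ_ξ hX, hc.curvature_ξ_ξ hφX, hc.nabla_ξ_phi hX]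
  simp only [map_sub, map_neg, phi, hc.nablaXi_nablaXi, map_add, h3, hc.symmPart_φ, neg_neg]
  simp only [phi] at hD
  have h2 := sub_eq_zero.2 (hD.trans h1.symm)
  rw [← sub_eq_zero, ← neg_eq_zero, ← h2]
  module

theorem h_ξ (x : M) : S.h S.ξ x = 0 := by
  rw [hc.h_eq S.smooth_ξ, S.φ_ξ, map_zero, neg_zero]

theorem η_h (hX : SmoothField X) (x : M) : S.η x (S.h X x) = 0 := by
  rw [hc.h_eq hX, map_neg, S.η_symmPart, neg_zero]

variable {f₁ f₂ f₃ f₄ f₅ f₆ : M → ℝ}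

theorem curvature_ξ_ξ_of_form (hform : S.IsGeneralizedKappaMuSpaceForm f₁ f₂ f₃ f₄ f₅ f₆)
    (hX : SmoothField X) (x : M) :
    curvature S.g X S.ξ S.ξ x
      = (f₁ x - f₃ x) • (X x - S.η x (X x) • S.ξ x) + (f₄ x - f₆ x) • S.h X x := by
  obtain ⟨-, -, -, -, -, -, hR⟩ := hform
  rw [hR X S.ξ S.ξ hX S.smooth_ξ S.smooth_ξ]
  simp only [R₁, R₂, R₃, R₄, R₅, R₆, phi, eta, S.φ_ξ, hc.h_ξ, S.inner_ξ, S.η_ξ, hc.η_h hX, S.η_φ,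
    map_zero, zero_apply]
  module

/-- For `κ = f₁ - f₃ = 1` the symmetric part `T` of `∇ξ` vanishes: the curvature hypothesis and
`φ_curvature_add` give `T² = 0`, and `T` is symmetric. -/
theorem symmPart_eq_zero (hform : S.IsGeneralizedKappaMuSpaceForm f₁ f₂ f₃ f₄ f₅ f₆)
    (hf : ∀ x, f₃ x = f₁ x - 1) (x : M) (v : TangentSpace I x) : S.symmPart x v = 0 := by
  obtain ⟨X, hX, rfl⟩ := exists_smoothField v
  have h := hc.φ_curvature_add hX x
  rw [hc.curvature_ξ_ξ_of_form hform hX, hc.curvature_ξ_ξ_of_form hform (S.smooth_phi hX), hf,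
    hc.h_eq hX, hc.h_eq (S.smooth_phi hX)] at h
  simp only [phi, map_add, map_sub, map_smul, map_neg, S.η_φ, S.φ_ξ, hc.symmPart_φ] at h
  have h2 : (2 : ℝ) • S.φ x (S.symmPart x (S.symmPart x (X x))) = 0 := by
    rw [← sub_eq_zero] at h
    rw [← h]
    module
  have h3 := congrArg (S.φ x) ((smul_eq_zero.1 h2).resolve_left two_ne_zero)
  rw [S.φ_φ, S.η_symmPart, zero_smul, add_zero, map_zero, neg_eq_zero] at h3
  by_contra hne
  have hpos := S.g.pos x _ hne
  rw [hc.symmPart_symm, h3, map_zero] at hpos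
  exact lt_irrefl _ hpos

end IsContactMetric

/-! ### The covariant derivative of `φ` and normality -/

/-- The vector field `(∇_X φ) Y = ∇_X (φ Y) - φ ∇_X Y`. -/
noncomputable def nablaPhi (S : AlmostContactMetricStructure I M) (X Y : Π x : M, TangentSpace I x)
    (x : M) : TangentSpace I x :=
  nabla S.g X (S.phi Y) x - S.φ x (nabla S.g X Y x)

/-- `∇_X φ` is skew-symmetric. -/
theorem inner_nablaPhi (hX : SmoothField X) (hY : SmoothField Y) (hZ : SmoothField Z) (x : M) :
    S.g.inner x (S.nablaPhi X Y x) (Z x) = -S.g.inner x (S.nablaPhi X Z x) (Y x) := by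
  have h1 := mvfderiv_inner_eq S.g hX (S.smooth_phi hY) hZ x
  have h2 := mvfderiv_inner_eq S.g hX hY (S.smooth_phi hZ) x
  have h3 : metricFun S.g (S.phi Y) Z = -metricFun S.g Y (S.phi Z) :=
    funext fun y ↦ S.inner_φ_left y _ _
  rw [h3, mvfderiv_neg, neg_apply, h2] at h1
  simp only [nablaPhi, map_sub, sub_apply]
  rw [S.inner_φ_left, S.inner_φ_left, S.g.symm x (nabla S.g X (S.phi Z) x)]
  have h4 := S.inner_φ_left x (Y x) (nabla S.g X Z x)
  have h5 := S.g.symm x (S.φ x (Y x)) (nabla S.g X Z x)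
  simp only [phi] at h1 ⊢
  linarith

/-- The Nijenhuis torsion of `φ` in terms of `∇φ`. -/
theorem nijenhuis_eq_nablaPhi (hX : SmoothField X) (hY : SmoothField Y) (x : M) :
    S.nijenhuis X Y x = S.nablaPhi (S.phi X) Y x - S.nablaPhi (S.phi Y) X x
      + S.φ x (S.nablaPhi Y X x) - S.φ x (S.nablaPhi X Y x) := by
  have hφX := S.smooth_phi hX
  have hφY := S.smooth_phi hY
  simp only [nijenhuis, nablaPhi, mlieBracket_eq_nabla_sub S.g hX hY,
    mlieBracket_eq_nabla_sub S.g hφX hφY, mlieBracket_eq_nabla_sub S.g hφX hY,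
    mlieBracket_eq_nabla_sub S.g hX hφY, map_sub]
  abel

namespace IsContactMetric

variable [T2Space M] (hc : S.IsContactMetric)
include hc

variable {f₁ f₂ f₃ f₄ f₅ f₆ : M → ℝ}

/-- Since `∇ξ = -φ`, the curvature `R(X, Y) ξ` is `(∇_Y φ) X - (∇_X φ) Y`. -/
theorem nablaPhi_sub_nablaPhi (hform : S.IsGeneralizedKappaMuSpaceForm f₁ f₂ f₃ f₄ f₅ f₆)
    (hf : ∀ x, f₃ x = f₁ x - 1) (hX : SmoothField X) (hY : SmoothField Y) (x : M) :
    S.nablaPhi X Y x - S.nablaPhi Y X x = S.η x (X x) • Y x - S.η x (Y x) • X x := by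
  have hT := hc.symmPart_eq_zero hform hf
  have hB : ∀ V : Π x : M, TangentSpace I x, nabla S.g V S.ξ = -S.phi V := fun V ↦ by
    ext1 y
    rw [S.nabla_ξ, S.nablaXi_eq_symmPart_sub, hT, zero_sub]
    rfl
  have hh : ∀ {V : Π x : M, TangentSpace I x}, SmoothField V → S.h V x = 0 := fun hV ↦ by
    rw [hc.h_eq hV, hT, neg_zero]
  obtain ⟨-, -, -, -, -, -, hR⟩ := hform
  have h := hR X Y S.ξ hX hY S.smooth_ξ x
  rw [curvature, hB, hB, hB, nabla_neg S.g (S.smooth_phi hX), nabla_neg S.g (S.smooth_phi hY),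
    Pi.neg_apply, phi, mlieBracket_eq_nabla_sub S.g hX hY, hf] at h
  simp only [R₁, R₂, R₃, R₄, R₅, R₆, phi, eta, S.φ_ξ, hh hX, hh hY, S.inner_ξ, S.η_ξ, map_zero,
    zero_apply, map_sub] at h
  rw [← sub_eq_zero] at h ⊢
  rw [← neg_eq_zero, ← h]
  simp only [nablaPhi]
  module

/-- `(∇_X φ) Y = g(X, Y) ξ - η(Y) X`. The difference of the two sides, paired with `Z`, is
symmetric in `X`, `Y` and skew-symmetric in `Y`, `Z`, hence zero. -/
theorem nablaPhi_eq (hform : S.IsGeneralizedKappaMuSpaceForm f₁ f₂ f₃ f₄ f₅ f₆)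
    (hf : ∀ x, f₃ x = f₁ x - 1) (hX : SmoothField X) (hY : SmoothField Y) (x : M) :
    S.nablaPhi X Y x = S.g.inner x (X x) (Y x) • S.ξ x - S.η x (Y x) • X x := by
  refine ext_inner S.g fun w ↦ ?_
  obtain ⟨Z, hZ, rfl⟩ := exists_smoothField w
  let Q (X Y Z : Π x : M, TangentSpace I x) : ℝ := S.g.inner x (S.nablaPhi X Y x) (Z x)
    - (S.g.inner x (X x) (Y x) * S.η x (Z x) - S.η x (Y x) * S.g.inner x (X x) (Z x))
  have hsymm : ∀ {X Y Z : Π x : M, TangentSpace I x}, SmoothField X → SmoothField Y →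
      Q X Y Z = Q Y X Z := by
    intro X Y Z hX hY
    have h := congrArg (fun v ↦ S.g.inner x v (Z x)) (hc.nablaPhi_sub_nablaPhi hform hf hX hY x)
    simp only [map_sub, map_smul, sub_apply, smul_apply, smul_eq_mul] at h
    simp only [Q, S.g.symm x (Y x) (X x)]
    linarith
  have hskew : ∀ {X Y Z : Π x : M, TangentSpace I x}, SmoothField X → SmoothField Y →
      SmoothField Z → Q X Y Z = -Q X Z Y := by
    intro X Y Z hX hY hZ
    simp only [Q, inner_nablaPhi hX hY hZ]
    ring
  have h0 : Q X Y Z = 0 := by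
    have h : Q X Y Z = -Q X Y Z := by
      calc Q X Y Z = Q Y X Z := hsymm hX hY
        _ = -Q Y Z X := hskew hY hX hZ
        _ = -Q Z Y X := by rw [hsymm hY hZ]
        _ = Q Z X Y := by rw [hskew hZ hY hX, neg_neg]
        _ = Q X Z Y := hsymm hZ hX
        _ = -Q X Y Z := hskew hX hZ hY
    linarith
  simp only [map_sub, map_smul, sub_apply, smul_apply, smul_eq_mul, S.inner_ξ_left]
  exact sub_eq_zero.1 h0

theorem isNormal (hform : S.IsGeneralizedKappaMuSpaceForm f₁ f₂ f₃ f₄ f₅ f₆)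
    (hf : ∀ x, f₃ x = f₁ x - 1) : S.IsNormal := by
  intro X Y hX hY x
  have hφX := S.smooth_phi hX
  have hφY := S.smooth_phi hY
  rw [nijenhuis_eq_nablaPhi hX hY, hc X Y hX hY, hc.nablaPhi_eq hform hf hφX hY,
    hc.nablaPhi_eq hform hf hφY hX, hc.nablaPhi_eq hform hf hY hX,
    hc.nablaPhi_eq hform hf hX hY]
  simp only [map_sub, map_smul, S.φ_ξ, phi, S.inner_φ_left, S.g.symm x (Y x) (S.φ x (X x))]
  module

end IsContactMetric

end Curvature

end AlmostContactMetricStructure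

end AlmostContact

theorem mainTheorem11 (n : ℕ)
    (M : Type*) [TopologicalSpace M] [T2Space M] [SecondCountableTopology M]
    [ChartedSpace (EuclideanSpace ℝ (Fin (2 * n + 1))) M] [IsManifold (𝓡 (2 * n + 1)) ∞ M]
    (S : AlmostContact.AlmostContactMetricStructure (𝓡 (2 * n + 1)) M)
    (f₁ f₂ f₃ f₄ f₅ f₆ : M → ℝ)
    (hform : S.IsGeneralizedKappaMuSpaceForm f₁ f₂ f₃ f₄ f₅ f₆)
    (hcontact : S.IsContactMetric)
    (hf : ∀ x, f₃ x = f₁ x - 1) :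
    S.IsSasakian :=
  ⟨hcontact, hcontact.isNormal hform hf⟩
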